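/- Let $n\ge 0$ and $I,N\ge 1$ be integers, $p\in[1,\infty)$, $\delta>0$, $\varepsilon\in(0,1)$, let $v_1,\dots,v_I\ge 1$ be integers, and let $\hat\xi^1,\dots,\hat\xi^N\in\{0,1\}^{I\times n}$ be data points, where $\xi_i\in\{0,1\}^n$ denotes the $i$-th row of $\xi\in\{0,1\}^{I\times n}$. Let $\hat{\mathbb P}=\frac1N\sum_{j=1}^N\Delta_{\hat\xi^j}$ be the empirical distribution ($\Delta_\xi$ is the point mass at $\xi$). For probability distributions $\mathbb P_1,\mathbb P_2$ on $\{0,1\}^{I\times n}$ let $$d_W(\mathbb P_1,\mathbb P_2)=\inf_{\mathbb Q}\ \mathbb E_{\mathbb Q}\big[\|X_1-X_2\|_p\big],$$ the infimum being over all joint distributions $\mathbb Q$ of $(X_1,X_2)$ with marginals $\mathbb P_1,\mathbb P_2$, where $\|\cdot\|_p$ is the entrywise $p$-norm, and let $\mathcal P$ be the set of all probability distributions $\mathbb P$ on $\{0,1\}^{I\times n}$ with $d_W(\mathbb P,\hat{\mathbb P})\le\delta$. Let $$Z=\Big\{x\in\{0,1\}^n:\ \inf_{\mathbb P\in\mathcal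 P}\mathbb P\{\xi:\ x^\top\xi_i\ge v_i\ \text{ for all } i=1,\dots,I\}\ \ge\ 1-\varepsilon\Big\}.$$ Write $a^+=\max\{a,0\}$, and set $g(x,\xi)=\min_{1\le i\le I}\big((x^\top\xi_i-v_i+1)^+\big)^{1/p}$. Then $$Z=\Big\{x\in\{0,1\}^n:\ \exists\,\gamma\ge 0,\ z\in\mathbb R^N\text{ with } z_j\le 0,\ \ \delta-\gamma\varepsilon\le\frac1N\sum_{j=1}^N z_j,\ \text{ and }\ z_j+\gamma\le\min_{1\le i\le I}\big((x^\top\hat\xi^j_i-v_i+1)^+\big)^{1/p}\ \text{ for all } j=1,\dots,N\Big\}.$$ In addition, for a random variable $X$ let $$\mathrm{CVaR}_{1-\varepsilon}(X)=\min_{\gamma\in\mathbb R}\Big\{\gamma+\frac1\varepsilon\,\mathbb E\big[(X-\gamma)^+\big]\Big\}.$$ For every $x\in\{0,1\}^n$ and $\hat\xi$ distributed according to $\hat{\mathbb P}$, this minimum is attained for $X=-g(x,\hat\xi)$, and $$Z=\Big\{x\in\{0,1\}^n:\ \frac{\delta}{\varepsilon}+\mathrm{CVaR}_{1-\varepsilon}\big[-g(x,\hat\xi)\big]\le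 0\Big\}.$$ -/

import Mathlib

open MeasureTheory
open scoped ENNReal

noncomputable section

/-- Binary vectors `x ∈ {0,1}^n`; `Fin 2` is the set `{0, 1}`. -/
abbrev BinVec (n : ℕ) : Type := Fin n → Fin 2

/-- Binary arrays `ξ ∈ {0,1}^{I × n}`, with rows `ξ i ∈ {0,1}^n`. The set is finite, and its
(product) σ-algebra consists of all subsets. -/
abbrev BinArray (I n : ℕ) : Type := Fin I → BinVec n

/-- The inner product `xᵀ y` of two binary vectors, an integer. -/
def binDot {n : ℕ} (x y : BinVec n) : ℤ := ∑ k, ((x k : ℕ) : ℤ) * ((y k : ℕ) : ℤ)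

/-- The distance `‖ξ - ζ‖_p` of two binary arrays: the `p`-norm of the difference, regarded as a
real vector with `I * n` entries. -/
def binDist {I n : ℕ} (p : ℝ≥0∞) (ξ ζ : BinArray I n) : ℝ :=
  ‖(WithLp.toLp p (fun q : Fin I × Fin n => ((ξ q.1 q.2 : ℕ) : ℝ) - ((ζ q.1 q.2 : ℕ) : ℝ)) :
    PiLp p (fun _ : Fin I × Fin n => ℝ))‖

/-- The couplings `Q ∼ (P₁, P₂)`: joint distributions with first marginal `P₁` and second
marginal `P₂`. -/
def couplings {Ω : Type*} [MeasurableSpace Ω] (P₁ P₂ : ProbabilityMeasure Ω) :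
    Set (ProbabilityMeasure (Ω × Ω)) :=
  {Q | (Q : Measure (Ω × Ω)).map Prod.fst = (P₁ : Measure Ω) ∧
       (Q : Measure (Ω × Ω)).map Prod.snd = (P₂ : Measure Ω)}

/-- The Wasserstein distance `d_W(P₁, P₂) = inf_{Q ∼ (P₁, P₂)} E_Q ‖X₁ - X₂‖_p` between
distributions on `{0,1}^{I × n}`. -/
def wassersteinDist {I n : ℕ} (p : ℝ≥0∞) (P₁ P₂ : ProbabilityMeasure (BinArray I n)) : ℝ≥0∞ :=
  ⨅ Q ∈ couplings P₁ P₂,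
    ∫⁻ w, ENNReal.ofReal (binDist p w.1 w.2) ∂(Q : Measure (BinArray I n × BinArray I n))

/-- The empirical distribution `(1/N) ∑ j, Δ_{ξ̂ j}` as a measure. -/
def empiricalMeasure {I n N : ℕ} (ξhat : Fin N → BinArray I n) : Measure (BinArray I n) :=
  (N : ℝ≥0∞)⁻¹ • ∑ j, Measure.dirac (ξhat j)

instance empiricalMeasure_isProbabilityMeasure {I n N : ℕ} [NeZero N]
    (ξhat : Fin N → BinArray I n) : IsProbabilityMeasure (empiricalMeasure ξhat) := by
  refine ⟨?_⟩
  have hN : (N : ℝ≥0∞) ≠ 0 := by exact_mod_cast NeZero.ne N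
  simp [empiricalMeasure, ENNReal.inv_mul_cancel hN (ENNReal.natCast_ne_top N)]

/-- The empirical distribution as a probability measure. -/
def empirical {I n N : ℕ} [NeZero N] (ξhat : Fin N → BinArray I n) :
    ProbabilityMeasure (BinArray I n) :=
  ⟨empiricalMeasure ξhat, inferInstance⟩

/-- The ambiguity set: all distributions on `{0,1}^{I × n}` within Wasserstein distance `δ` of
the empirical distribution. -/
def ambiguitySet {I n N : ℕ} [NeZero N] (p : ℝ≥0∞) (δ : ℝ) (ξhat : Fin N → BinArray I n) :
    Set (ProbabilityMeasure (BinArray I n)) :=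
  {P | wassersteinDist p P (empirical ξhat) ≤ ENNReal.ofReal δ}

/-- The feasible region `Z` of the distributionally robust chance constraint
`inf_{P ∈ 𝒫} P {ξ | xᵀ ξ i ≥ v i for all i} ≥ 1 - ε` over `x ∈ {0,1}^n`. -/
def feasibleRegion {I n N : ℕ} [NeZero N] (p : ℝ≥0∞) (δ ε : ℝ) (v : Fin I → ℤ)
    (ξhat : Fin N → BinArray I n) : Set (BinVec n) :=
  {x | (⨅ P ∈ ambiguitySet p δ ξhat,
      (P : Measure (BinArray I n)) {ξ | ∀ i, binDot x (ξ i) ≥ v i}) ≥ ENNReal.ofReal (1 - ε)}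

/-- `g(x, ξ) = min_i ((xᵀ ξ i - v i + 1)⁺)^{1/p}`. -/
def gFun {I n : ℕ} [NeZero I] (p : ℝ≥0∞) (v : Fin I → ℤ) (x : BinVec n) (ξ : BinArray I n) : ℝ :=
  Finset.univ.inf' Finset.univ_nonempty
    (fun i : Fin I => (max ((binDot x (ξ i) : ℝ) - (v i : ℝ) + 1) 0) ^ (1 / p.toReal))

/-- The function `γ ↦ γ + (1/ε) E (X - γ)⁺` whose minimum is the conditional value-at-risk. -/
def cvarObjective {Ω : Type*} [MeasurableSpace Ω] (P : ProbabilityMeasure Ω) (ε : ℝ) (X : Ω → ℝ)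
    (γ : ℝ) : ℝ :=
  γ + 1 / ε * ∫ ω, max (X ω - γ) 0 ∂(P : Measure Ω)

/-- The conditional value-at-risk `CVaR_{1-ε}(X)` of a random variable `X` under `P`, the minimum
over `γ` of `γ + (1/ε) E (X - γ)⁺`. -/
def cvar {Ω : Type*} [MeasurableSpace Ω] (P : ProbabilityMeasure Ω) (ε : ℝ) (X : Ω → ℝ) : ℝ :=
  ⨅ γ : ℝ, cvarObjective P ε X γ

end

/-! ### Distance of a binary array to the set of unsafe arrays -/

/-! `gFun` is exactly the distance from a point to the unsafe set (`gFun_le_binDist`,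
`exists_binDist_eq_gFun`). The adversary therefore faces a fractional knapsack: move a fraction w_j
of each atom, at cost (1/N) ∑ w_j g_j ≤ δ, to make as much mass unsafe as possible. Feasibility
means that this maximum is at most ε, which by duality amounts to some γ with δ + (1/N) ∑ (γ - g_j)⁺
≤ εγ (`mem_feasibleRegion_iff`). Sufficiency is weak duality, integrated over couplings. For
necessity, `exists_knapsack_weights` supplies the primal optimum; if its γ fails, the budget has
slack and more than ε can be moved. Taking z_j = -(γ - g_j)⁺ gives the first description; dividing
by ε and replacing γ by -γ gives CVaR. -/

theorem binDist_eq {I n : ℕ} {p : ℝ≥0∞} (hp : 0 < p.toReal) (ξ ζ : BinArray I n) :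
    binDist p ξ ζ =
      (∑ i, ∑ k, (if ξ i k = ζ i k then (0 : ℝ) else 1)) ^ (1 / p.toReal) := by
  rw [binDist, PiLp.norm_eq_sum hp, Fintype.sum_prod_type]
  congr 1
  refine Finset.sum_congr rfl fun i _ => Finset.sum_congr rfl fun k _ => ?_
  simp only
  generalize ξ i k = a
  generalize ζ i k = b
  fin_cases a <;> fin_cases b <;> simp [Real.zero_rpow hp.ne']

theorem binDist_nonneg {I n : ℕ} {p : ℝ≥0∞} (hp : 0 < p.toReal) (ξ ζ : BinArray I n) :
    0 ≤ binDist p ξ ζ := by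
  rw [binDist_eq hp]
  exact Real.rpow_nonneg (Finset.sum_nonneg fun i _ => Finset.sum_nonneg fun k _ => by
    split_ifs <;> norm_num) _

theorem binDist_self {I n : ℕ} {p : ℝ≥0∞} (hp : 0 < p.toReal) (ξ : BinArray I n) :
    binDist p ξ ξ = 0 := by
  rw [binDist_eq hp]
  simp [Real.zero_rpow (inv_pos.2 hp).ne']

theorem gFun_nonneg {I n : ℕ} [NeZero I] (p : ℝ≥0∞) (v : Fin I → ℤ) (x : BinVec n)
    (ξ : BinArray I n) : 0 ≤ gFun p v x ξ :=
  (Finset.le_inf'_iff _ _).2 fun _ _ => Real.rpow_nonneg (le_max_right _ _) _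

theorem binDot_sub_le {n : ℕ} (x y y' : BinVec n) :
    (binDot x y : ℝ) - binDot x y' ≤ ∑ k, (if y' k = y k then (0 : ℝ) else 1) := by
  simp only [binDot, Int.cast_sum, ← Finset.sum_sub_distrib]
  refine Finset.sum_le_sum fun k _ => ?_
  generalize x k = a
  generalize y k = b
  generalize y' k = c
  fin_cases a <;> fin_cases b <;> fin_cases c <;> simp

theorem gFun_le_binDist {I n : ℕ} [NeZero I] {p : ℝ≥0∞} (hp : 0 < p.toReal) (v : Fin I → ℤ)
    (x : BinVec n) (ξ ζ : BinArray I n) (hζ : ¬ ∀ i, binDot x (ζ i) ≥ v i) :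
    gFun p v x ξ ≤ binDist p ζ ξ := by
  push Not at hζ
  obtain ⟨i, hi⟩ := hζ
  -- Integrality is the source of the `+ 1` in `gFun`.
  have hi' : (binDot x (ζ i) : ℝ) + 1 ≤ v i := by exact_mod_cast hi
  refine (Finset.inf'_le _ (Finset.mem_univ i)).trans ?_
  rw [binDist_eq hp]
  have hrow : ∀ i, (0 : ℝ) ≤ ∑ k, (if ζ i k = ξ i k then (0 : ℝ) else 1) := fun i =>
    Finset.sum_nonneg fun k _ => by split_ifs <;> norm_num
  refine Real.rpow_le_rpow (le_max_right _ _) (max_le ?_ ?_) (by positivity)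
  · have h1 := binDot_sub_le x (ξ i) (ζ i)
    have h2 := Finset.single_le_sum (fun i _ => hrow i) (Finset.mem_univ i)
    linarith
  · exact Finset.sum_nonneg fun i _ => hrow i

theorem binDot_eq_card {n : ℕ} (x y : BinVec n) :
    binDot x y = ((Finset.univ.filter fun k => x k = 1 ∧ y k = 1).card : ℤ) := by
  rw [binDot, Finset.card_filter, Nat.cast_sum]
  refine Finset.sum_congr rfl fun k _ => ?_
  generalize x k = a
  generalize y k = b
  fin_cases a <;> fin_cases b <;> simp

/-- In a row attaining the minimum, erase just enough ones on the support of `x`; each erasure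
lowers the product by one and adds one to the p-th power of the distance. -/
theorem exists_binDist_eq_gFun {I n : ℕ} [NeZero I] {p : ℝ≥0∞} (hp : 0 < p.toReal)
    {v : Fin I → ℤ} (hv : ∀ i, 1 ≤ v i) (x : BinVec n) (ξ : BinArray I n) :
    ∃ ζ : BinArray I n, (¬ ∀ i, binDot x (ζ i) ≥ v i) ∧ binDist p ζ ξ = gFun p v x ξ := by
  obtain ⟨i, -, hi⟩ := Finset.exists_mem_eq_inf' (Finset.univ_nonempty (α := Fin I))
    (fun i : Fin I => (max ((binDot x (ξ i) : ℝ) - (v i : ℝ) + 1) 0) ^ (1 / p.toReal))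
  set A := Finset.univ.filter fun k => x k = 1 ∧ ξ i k = 1 with hA
  have hcard : binDot x (ξ i) = (A.card : ℤ) := binDot_eq_card x (ξ i)
  -- Truncation gives `m = 0` if the row is already violated; `1 ≤ v i` ensures that there are `m`
  -- ones to erase.
  set m := (binDot x (ξ i) - v i + 1).toNat with hm
  have hmA : m ≤ A.card := by have := hv i; omega
  obtain ⟨T, hTA, hTm⟩ := Finset.exists_subset_card_eq hmA
  have hT : ∀ k ∈ T, x k = 1 ∧ ξ i k = 1 := fun k hk => by simpa [hA] using hTA hk
  refine ⟨Function.update ξ i fun k => if k ∈ T then 0 else ξ i k, ?_, ?_⟩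
  · intro h
    have h1 := h i
    have h2 : (Finset.univ.filter fun k => x k = 1 ∧ (if k ∈ T then 0 else ξ i k) = 1)
        = A \ T := by
      ext k
      by_cases hk : k ∈ T <;> simp [hA, hk]
    rw [Function.update_self, binDot_eq_card, h2, Finset.card_sdiff_of_subset hTA] at h1
    omega
  · rw [binDist_eq hp, gFun, hi]
    congr 1
    rw [Finset.sum_eq_single i]
    · have h3 : ∀ k, (if Function.update ξ i (fun k => if k ∈ T then 0 else ξ i k) i k = ξ i k
          then (0 : ℝ) else 1) = if k ∈ T then 1 else 0 := by
        intro k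
        rw [Function.update_self]
        by_cases hk : k ∈ T
        · simp [hk, (hT k hk).2]
        · simp [hk]
      simp only [h3]
      rw [Finset.sum_ite_mem, Finset.univ_inter, Finset.sum_const, hTm, nsmul_eq_mul, mul_one]
      have h4 : (m : ℤ) = max (binDot x (ξ i) - v i + 1) 0 := Int.ofNat_toNat _
      exact_mod_cast h4
    · intro j _ hj
      simp [Function.update_of_ne hj]
    · simp

/-! ### Quantiles and the fractional knapsack -/

theorem exists_quantile {ι : Type*} [Fintype ι] [Nonempty ι] (g : ι → ℝ) {c : ℝ} (hc : 0 ≤ c)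
    (hc' : c ≤ Fintype.card ι) :
    ∃ γ, ((Finset.univ.filter fun j => g j < γ).card : ℝ) ≤ c ∧
      c ≤ (Finset.univ.filter fun j => g j ≤ γ).card := by
  classical
  set B := Finset.univ.filter fun i => c ≤ (Finset.univ.filter fun j => g j ≤ g i).card with hB
  have hBne : B.Nonempty := by
    obtain ⟨i, hi⟩ := Finite.exists_max g
    exact ⟨i, by simpa [hB, hi] using hc'⟩
  obtain ⟨i, hiB, hmin⟩ := Finset.exists_min_image B g hBne
  refine ⟨g i, ?_, by simpa [hB] using hiB⟩
  by_contra! hlt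
  have hne : (Finset.univ.filter fun j => g j < g i).Nonempty := by
    rw [Finset.nonempty_iff_ne_empty]
    intro h
    rw [h] at hlt
    simp at hlt
    linarith
  -- The points at or below the largest value under `g i` are those strictly below `g i`, more than
  -- `c` of them, so `k` contradicts minimality.
  obtain ⟨k, hk, hmax⟩ := Finset.exists_max_image _ g hne
  have hki : g k < g i := by simpa using hk
  refine absurd (hmin k ?_) (not_le.2 hki)
  simp only [hB, Finset.mem_filter, Finset.mem_univ, true_and]
  refine hlt.le.trans (Nat.cast_le.2 (Finset.card_le_card fun j hj => ?_))
  simpa using hmax j hj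

/-- Fill the cheapest items first: weight 1 below the quantile `γ`, 0 above, and a common `θ` on
ties, tuned to make the total `c`. The last clause is complementary slackness. -/
theorem exists_knapsack_weights {ι : Type*} [Fintype ι] [Nonempty ι] (g : ι → ℝ) {c : ℝ}
    (hc : 0 ≤ c) (hc' : c ≤ Fintype.card ι) :
    ∃ (γ : ℝ) (w : ι → ℝ), (∀ j, 0 ≤ w j) ∧ (∀ j, w j ≤ 1) ∧ ∑ j, w j = c ∧
      ∀ j, max (γ - g j) 0 = w j * (γ - g j) := by
  classical
  obtain ⟨γ, h1, h2⟩ := exists_quantile g hc hc'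
  obtain ⟨θ, hθ0, hθ1, hθ⟩ : ∃ θ : ℝ, 0 ≤ θ ∧ θ ≤ 1 ∧
      (1 - θ) * ((Finset.univ.filter fun j => g j < γ).card : ℝ) +
        θ * (Finset.univ.filter fun j => g j ≤ γ).card = c := by
    rcases (h1.trans h2).eq_or_lt with h | h
    · exact ⟨0, le_rfl, zero_le_one, by linarith⟩
    · have hpos := sub_pos.2 h
      refine ⟨(c - (Finset.univ.filter fun j => g j < γ).card) /
        ((Finset.univ.filter fun j => g j ≤ γ).card -
          (Finset.univ.filter fun j => g j < γ).card), div_nonneg (sub_nonneg.2 h1) hpos.le,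
        (div_le_one hpos).2 (by linarith), ?_⟩
      field_simp
      ring
  refine ⟨γ, fun j => (1 - θ) * (if g j < γ then 1 else 0) + θ * (if g j ≤ γ then 1 else 0),
    fun j => ?_, fun j => ?_, ?_, fun j => ?_⟩
  · dsimp only
    split_ifs <;> linarith
  · dsimp only
    split_ifs <;> linarith
  · rw [Finset.sum_add_distrib, ← Finset.mul_sum, ← Finset.mul_sum, Finset.sum_boole,
      Finset.sum_boole, hθ]
  · rcases lt_trichotomy (g j) γ with h | h | h
    · simp [h, h.le]
    · simp [h]
    · simp [not_lt.2 h.le, not_le.2 h, h.le]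

/-! ### Expectations under the empirical distribution -/

theorem integral_empirical {I n N : ℕ} [NeZero N] (ξhat : Fin N → BinArray I n)
    (f : BinArray I n → ℝ) :
    ∫ ξ, f ξ ∂(empirical ξhat : Measure (BinArray I n)) = 1 / (N : ℝ) * ∑ j, f (ξhat j) := by
  change ∫ ξ, f ξ ∂(empiricalMeasure ξhat) = _
  rw [empiricalMeasure, integral_smul_measure, integral_finsetSum_measure]
  · simp
  · intro j _
    exact integrable_dirac (by simp)

theorem cvarObjective_empirical {I n N : ℕ} [NeZero N] (ξhat : Fin N → BinArray I n) {ε : ℝ}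
    (hε : 0 < ε) (g : BinArray I n → ℝ) (γ : ℝ) :
    cvarObjective (empirical ξhat) ε (fun ξ => -g ξ) (-γ) =
      (1 / (N : ℝ) * ∑ j, max (γ - g (ξhat j)) 0 - ε * γ) / ε := by
  rw [cvarObjective, integral_empirical]
  have : ∀ j, -g (ξhat j) - -γ = γ - g (ξhat j) := fun j => by ring
  simp only [this]
  field_simp
  ring

theorem isLeast_cvar_empirical {I n N : ℕ} [NeZero N] (ξhat : Fin N → BinArray I n) {ε : ℝ}
    (hε : 0 < ε) (hε' : ε < 1) (g : BinArray I n → ℝ) :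
    IsLeast (Set.range (cvarObjective (empirical ξhat) ε (fun ξ => -g ξ)))
      (cvar (empirical ξhat) ε (fun ξ => -g ξ)) := by
  have hN : (0 : ℝ) < N := Nat.cast_pos.2 (NeZero.pos N)
  obtain ⟨γ, w, hw0, hw1, hws, hw⟩ := exists_knapsack_weights (fun j => g (ξhat j))
    (c := ε * N) (by positivity) (by simpa using mul_le_of_le_one_left hN.le hε'.le)
  suffices h : IsLeast (Set.range (cvarObjective (empirical ξhat) ε (fun ξ => -g ξ)))
      (cvarObjective (empirical ξhat) ε (fun ξ => -g ξ) (-γ)) by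
    have : cvar (empirical ξhat) ε (fun ξ => -g ξ) = _ := h.csInf_eq
    rwa [this]
  refine ⟨⟨_, rfl⟩, ?_⟩
  rintro _ ⟨t, rfl⟩
  obtain ⟨s, rfl⟩ : ∃ s, t = -s := ⟨-t, by ring⟩
  rw [cvarObjective_empirical ξhat hε, cvarObjective_empirical ξhat hε]
  refine div_le_div_of_nonneg_right ?_ hε.le
  -- As the weights sum to `ε * N`, the term linear in `u` cancels against `ε * u`, leaving a lower
  -- bound independent of `u` and attained at `γ`.
  have key : ∀ u, ∑ j, w j * (u - g (ξhat j)) = ε * N * u - ∑ j, w j * g (ξhat j) := fun u => by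
    simp only [mul_sub, Finset.sum_sub_distrib, ← Finset.sum_mul, hws]
  have h1 : ∑ j, max (γ - g (ξhat j)) 0 = ε * N * γ - ∑ j, w j * g (ξhat j) := by
    rw [← key]
    exact Finset.sum_congr rfl fun j _ => hw j
  have h2 : ε * N * s - ∑ j, w j * g (ξhat j) ≤ ∑ j, max (s - g (ξhat j)) 0 := by
    rw [← key]
    refine Finset.sum_le_sum fun j _ => ?_
    rcases le_total 0 (s - g (ξhat j)) with h | h
    · exact (mul_le_of_le_one_left h (hw1 j)).trans (le_max_left _ _)
    · exact (mul_nonpos_of_nonneg_of_nonpos (hw0 j) h).trans (le_max_right _ _)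
  have h3 : 1 / (N : ℝ) * (ε * N * γ - ∑ j, w j * g (ξhat j)) - ε * γ =
      1 / (N : ℝ) * (ε * N * s - ∑ j, w j * g (ξhat j)) - ε * s := by
    field_simp
    ring
  rw [h1, h3]
  gcongr

/-! ### The worst-case probability of the safe set -/

/-- Weak duality: γ·1[ζ unsafe] ≤ ‖ζ - ξ‖ + (γ - g(ξ))⁺ holds pointwise and is integrated against
any coupling. -/
theorem mul_measure_unsafe_le {I n N : ℕ} [NeZero I] [NeZero N] {p : ℝ≥0∞} (hp : 0 < p.toReal)
    (v : Fin I → ℤ) (ξhat : Fin N → BinArray I n) (x : BinVec n)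
    (P : ProbabilityMeasure (BinArray I n)) (γ : ℝ) :
    ENNReal.ofReal γ * (P : Measure (BinArray I n)) {ξ | ∀ i, binDot x (ξ i) ≥ v i}ᶜ ≤
      wassersteinDist p P (empirical ξhat) +
        ENNReal.ofReal (1 / (N : ℝ) * ∑ j, max (γ - gFun p v x (ξhat j)) 0) := by
  set S : Set (BinArray I n) := {ξ | ∀ i, binDot x (ξ i) ≥ v i} with hS
  have hSm : MeasurableSet Sᶜ := (Set.toFinite _).measurableSet
  have hexp : ENNReal.ofReal (1 / (N : ℝ) * ∑ j, max (γ - gFun p v x (ξhat j)) 0) =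
      ∫⁻ ξ, ENNReal.ofReal (max (γ - gFun p v x ξ) 0)
        ∂(empirical ξhat : Measure (BinArray I n)) := by
    rw [← integral_empirical ξhat (fun ξ => max (γ - gFun p v x ξ) 0),
      ofReal_integral_eq_lintegral_ofReal (f := fun ξ => max (γ - gFun p v x ξ) 0)
        Integrable.of_finite (Filter.Eventually.of_forall fun _ => le_max_right _ _)]
  rw [hexp, wassersteinDist, ENNReal.iInf₂_add]
  refine le_iInf₂ fun Q hQ => ?_
  rw [← hQ.1, ← hQ.2, lintegral_map (measurable_of_finite _) measurable_snd,
    ← lintegral_indicator_one hSm, lintegral_map (measurable_of_finite _) measurable_fst,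
    ← lintegral_const_mul _ (measurable_of_finite _),
    ← lintegral_add_left (measurable_of_finite _)]
  refine lintegral_mono fun w => ?_
  by_cases hw : w.1 ∈ S
  · simp [Set.indicator, hw]
  · rw [← ENNReal.ofReal_add (binDist_nonneg hp _ _) (le_max_right _ _)]
    simp only [Set.indicator, Set.mem_compl_iff, hw, not_false_eq_true, if_true, Pi.one_apply,
      mul_one]
    refine ENNReal.ofReal_le_ofReal ?_
    have h1 := gFun_le_binDist hp v x w.2 w.1 hw
    have h2 := le_max_left (γ - gFun p v x w.2) 0
    linarith

theorem mem_feasibleRegion_of_le {I n N : ℕ} [NeZero I] [NeZero N] {p : ℝ≥0∞}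
    (hp : 0 < p.toReal) {δ ε : ℝ} (hδ : 0 < δ) (hε : 0 < ε)
    (v : Fin I → ℤ) (ξhat : Fin N → BinArray I n) (x : BinVec n) {γ : ℝ}
    (hγ : δ + 1 / (N : ℝ) * ∑ j, max (γ - gFun p v x (ξhat j)) 0 ≤ ε * γ) :
    x ∈ feasibleRegion p δ ε v ξhat := by
  have hE : 0 ≤ 1 / (N : ℝ) * ∑ j, max (γ - gFun p v x (ξhat j)) 0 :=
    mul_nonneg (by positivity) (Finset.sum_nonneg fun _ _ => le_max_right _ _)
  have hγ0 : 0 < γ := by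
    by_contra! h
    have := mul_nonpos_of_nonneg_of_nonpos hε.le h
    linarith
  change ENNReal.ofReal (1 - ε) ≤ ⨅ P ∈ ambiguitySet p δ ξhat,
    (P : Measure (BinArray I n)) {ξ | ∀ i, binDot x (ξ i) ≥ v i}
  refine le_iInf₂ fun P hP => ?_
  have h1 := (mul_measure_unsafe_le hp v ξhat x P γ).trans (add_le_add_left hP _)
  rw [← ENNReal.ofReal_add hδ.le hE] at h1
  have h2 := h1.trans (ENNReal.ofReal_le_ofReal hγ)
  rw [mul_comm ε, ENNReal.ofReal_mul hγ0.le,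
    ENNReal.mul_le_mul_iff_right (by simpa using hγ0) ENNReal.ofReal_ne_top] at h2
  have h3 := prob_add_prob_compl (μ := (P : Measure (BinArray I n)))
    (s := {ξ | ∀ i, binDot x (ξ i) ≥ v i}) (Set.toFinite _).measurableSet
  rw [ENNReal.ofReal_sub _ hε.le, ENNReal.ofReal_one, tsub_le_iff_right, ← h3]
  gcongr

/-- The joint distribution that moves the fraction `w j` of the mass of the `j`-th data point
to `ζ j`. -/
noncomputable def transportPlan {Ω : Type*} [MeasurableSpace Ω] {N : ℕ} (ξ ζ : Fin N → Ω) (w : Fin N → ℝ) :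
    Measure (Ω × Ω) :=
  (N : ℝ≥0∞)⁻¹ • ∑ j, (ENNReal.ofReal (w j) • Measure.dirac (ζ j, ξ j) +
    ENNReal.ofReal (1 - w j) • Measure.dirac (ξ j, ξ j))

theorem transportPlan_map_snd {I n N : ℕ} (ξ ζ : Fin N → BinArray I n) {w : Fin N → ℝ}
    (hw0 : ∀ j, 0 ≤ w j) (hw1 : ∀ j, w j ≤ 1) :
    (transportPlan ξ ζ w).map Prod.snd = empiricalMeasure ξ := by
  have h : ∀ j, ENNReal.ofReal (w j) + ENNReal.ofReal (1 - w j) = 1 := fun j => by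
    rw [← ENNReal.ofReal_add (hw0 j) (sub_nonneg.2 (hw1 j))]
    simp
  ext s hs
  rw [Measure.map_apply measurable_snd hs]
  simp only [transportPlan, empiricalMeasure, Measure.smul_apply, Measure.finsetSum_apply,
    Measure.add_apply, smul_eq_mul, Measure.dirac_apply' _ hs,
    Measure.dirac_apply' _ (measurable_snd hs)]
  congr 1
  refine Finset.sum_congr rfl fun j _ => ?_
  have : ∀ a : BinArray I n, (Prod.snd ⁻¹' s).indicator (1 : BinArray I n × BinArray I n → ℝ≥0∞)
      (a, ξ j) = s.indicator 1 (ξ j) := fun a => by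
    simp only [Set.indicator, Set.mem_preimage]
    rfl
  rw [this, this, ← add_mul, h, one_mul]

theorem lintegral_transportPlan {I n N : ℕ} [NeZero N] (ξ ζ : Fin N → BinArray I n)
    {w : Fin N → ℝ} (hw0 : ∀ j, 0 ≤ w j) (hw1 : ∀ j, w j ≤ 1)
    {f : BinArray I n × BinArray I n → ℝ} (hf : ∀ a, 0 ≤ f a) :
    ∫⁻ a, ENNReal.ofReal (f a) ∂(transportPlan ξ ζ w) =
      ENNReal.ofReal (1 / (N : ℝ) * ∑ j, (w j * f (ζ j, ξ j) + (1 - w j) * f (ξ j, ξ j))) := by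
  have hN : (0 : ℝ) < N := Nat.cast_pos.2 (NeZero.pos N)
  have h1 : ∀ j, 0 ≤ 1 - w j := fun j => sub_nonneg.2 (hw1 j)
  rw [transportPlan, lintegral_smul_measure, lintegral_finsetSum_measure,
    ENNReal.ofReal_mul (by positivity), ENNReal.ofReal_sum_of_nonneg fun j _ =>
      add_nonneg (mul_nonneg (hw0 j) (hf _)) (mul_nonneg (h1 j) (hf _))]
  congr 1
  · rw [one_div, ENNReal.ofReal_inv_of_pos hN, ENNReal.ofReal_natCast]
  · refine Finset.sum_congr rfl fun j _ => ?_
    rw [lintegral_add_measure, lintegral_smul_measure, lintegral_smul_measure, lintegral_dirac,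
      lintegral_dirac, ENNReal.ofReal_add (mul_nonneg (hw0 j) (hf _)) (mul_nonneg (h1 j) (hf _)),
      ENNReal.ofReal_mul (hw0 j), ENNReal.ofReal_mul (h1 j), smul_eq_mul, smul_eq_mul]

/-- Sending the fraction `w j` of each atom to its nearest unsafe point costs at most `δ`, so the
resulting law is admissible. -/
theorem moved_mass_le_of_mem_feasibleRegion {I n N : ℕ} [NeZero I] [NeZero N] {p : ℝ≥0∞}
    (hp : 0 < p.toReal) {δ ε : ℝ} {v : Fin I → ℤ} (hv : ∀ i, 1 ≤ v i)
    (ξhat : Fin N → BinArray I n) {x : BinVec n} (hx : x ∈ feasibleRegion p δ ε v ξhat)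
    {w : Fin N → ℝ} (hw0 : ∀ j, 0 ≤ w j) (hw1 : ∀ j, w j ≤ 1)
    (hcost : 1 / (N : ℝ) * ∑ j, w j * gFun p v x (ξhat j) ≤ δ) :
    1 / (N : ℝ) * ∑ j, w j ≤ ε := by
  have hN : (0 : ℝ) < N := Nat.cast_pos.2 (NeZero.pos N)
  choose ζ hζ hζd using fun j => exists_binDist_eq_gFun hp hv x (ξhat j)
  have hsnd := transportPlan_map_snd ξhat ζ hw0 hw1
  have hQp : IsProbabilityMeasure (transportPlan ξhat ζ w) := by
    refine ⟨?_⟩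
    have h : (empiricalMeasure ξhat) Set.univ = 1 := measure_univ
    rwa [← hsnd, Measure.map_apply measurable_snd MeasurableSet.univ, Set.preimage_univ] at h
  let Q : ProbabilityMeasure (BinArray I n × BinArray I n) := ⟨transportPlan ξhat ζ w, hQp⟩
  let P : ProbabilityMeasure (BinArray I n) :=
    ⟨(transportPlan ξhat ζ w).map Prod.fst,
      Measure.isProbabilityMeasure_map measurable_fst.aemeasurable⟩
  have hP : P ∈ ambiguitySet p δ ξhat := by
    change wassersteinDist p P (empirical ξhat) ≤ _
    have hQ : Q ∈ couplings P (empirical ξhat) := ⟨rfl, hsnd⟩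
    refine (iInf₂_le Q hQ).trans ?_
    change ∫⁻ a, ENNReal.ofReal (binDist p a.1 a.2) ∂(transportPlan ξhat ζ w) ≤ _
    rw [lintegral_transportPlan ξhat ζ hw0 hw1 (f := fun a => binDist p a.1 a.2)
      fun a => binDist_nonneg hp _ _]
    refine ENNReal.ofReal_le_ofReal ?_
    simpa only [hζd, binDist_self hp, mul_zero, add_zero] using hcost
  set S : Set (BinArray I n) := {ξ | ∀ i, binDot x (ξ i) ≥ v i} with hS
  have hSm : MeasurableSet S := (Set.toFinite _).measurableSet
  have hPS : ENNReal.ofReal (1 - ε) ≤ (transportPlan ξhat ζ w).map Prod.fst S :=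
    (show ENNReal.ofReal (1 - ε) ≤ _ from hx).trans (iInf₂_le P hP)
  classical
  have hval : (transportPlan ξhat ζ w).map Prod.fst S = ENNReal.ofReal (1 / (N : ℝ) *
      ∑ j, (w j * (if ζ j ∈ S then 1 else 0) + (1 - w j) * (if ξhat j ∈ S then 1 else 0))) := by
    rw [← lintegral_indicator_one hSm, lintegral_map (measurable_of_finite _) measurable_fst,
      ← lintegral_transportPlan ξhat ζ hw0 hw1 (f := fun a => if a.1 ∈ S then 1 else 0)
        fun a => by split_ifs <;> norm_num]
    refine lintegral_congr fun a => ?_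
    by_cases h : a.1 ∈ S <;> simp [h]
  -- Only unmoved mass can be safe; an inequality, since a data point may itself be unsafe.
  have hle : 1 / (N : ℝ) * ∑ j, (w j * (if ζ j ∈ S then 1 else 0) +
      (1 - w j) * (if ξhat j ∈ S then 1 else 0)) ≤ 1 / (N : ℝ) * ∑ j, (1 - w j) := by
    refine mul_le_mul_of_nonneg_left (Finset.sum_le_sum fun j _ => ?_) (by positivity)
    have : ζ j ∉ S := hζ j
    have := hw1 j
    split_ifs <;> simp_all
  have h0 : 0 ≤ 1 / (N : ℝ) * ∑ j, (1 - w j) :=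
    mul_nonneg (by positivity) (Finset.sum_nonneg fun j _ => sub_nonneg.2 (hw1 j))
  have h1 := (ENNReal.ofReal_le_ofReal_iff h0).1
    ((hPS.trans_eq hval).trans (ENNReal.ofReal_le_ofReal hle))
  have h2 : 1 / (N : ℝ) * ∑ j, (1 - w j) = 1 - 1 / (N : ℝ) * ∑ j, w j := by
    rw [Finset.sum_sub_distrib, mul_sub]
    simp [hN.ne']
  linarith

theorem exists_le_of_mem_feasibleRegion {I n N : ℕ} [NeZero I] [NeZero N] {p : ℝ≥0∞}
    (hp : 0 < p.toReal) {δ ε : ℝ} (hε : 0 < ε) (hε' : ε < 1) {v : Fin I → ℤ}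
    (hv : ∀ i, 1 ≤ v i) (ξhat : Fin N → BinArray I n) {x : BinVec n}
    (hx : x ∈ feasibleRegion p δ ε v ξhat) :
    ∃ γ, δ + 1 / (N : ℝ) * ∑ j, max (γ - gFun p v x (ξhat j)) 0 ≤ ε * γ := by
  have hN : (0 : ℝ) < N := Nat.cast_pos.2 (NeZero.pos N)
  obtain ⟨γ, w, hw0, hw1, hws, hw⟩ := exists_knapsack_weights (fun j => gFun p v x (ξhat j))
    (c := ε * N) (by positivity) (by simpa using mul_le_of_le_one_left hN.le hε'.le)
  refine ⟨γ, ?_⟩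
  by_contra! hlt
  set c := 1 / (N : ℝ) * ∑ j, w j * gFun p v x (ξhat j) with hc
  set G := 1 / (N : ℝ) * ∑ j, gFun p v x (ξhat j) with hG
  -- By complementary slackness the average of (γ - g_j)⁺ equals εγ - c.
  have hcδ : c < δ := by
    simp only [hw, mul_sub, Finset.sum_sub_distrib, ← Finset.sum_mul, hws] at hlt
    have : 1 / (N : ℝ) * (ε * N * γ) = ε * γ := by field_simp
    linarith
  have hG0 : 0 ≤ G := mul_nonneg (by positivity) (Finset.sum_nonneg fun j _ => gFun_nonneg _ _ _ _)
  have hc0 : 0 ≤ c := mul_nonneg (by positivity)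
    (Finset.sum_nonneg fun j _ => mul_nonneg (hw0 j) (gFun_nonneg _ _ _ _))
  -- The slack δ - c pays for pushing all weights towards 1 by a fraction `s`, raising the moved
  -- mass to ε + s(1 - ε) > ε. Dividing by `G + 1` covers `G = 0`.
  obtain ⟨s, hs0, hs1, hs⟩ : ∃ s : ℝ, 0 < s ∧ s ≤ 1 ∧ s * G ≤ δ - c := by
    refine ⟨min 1 ((δ - c) / (G + 1)), lt_min one_pos (div_pos (sub_pos.2 hcδ) (by linarith)),
      min_le_left _ _, ?_⟩
    calc min 1 ((δ - c) / (G + 1)) * G ≤ (δ - c) / (G + 1) * (G + 1) :=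
          mul_le_mul (min_le_right _ _) (by linarith) hG0
            (div_nonneg (sub_pos.2 hcδ).le (by linarith))
      _ = δ - c := div_mul_cancel₀ _ (by linarith)
  have key := moved_mass_le_of_mem_feasibleRegion hp hv ξhat hx
    (w := fun j => (1 - s) * w j + s)
    (fun j => add_nonneg (mul_nonneg (sub_nonneg.2 hs1) (hw0 j)) hs0.le)
    (fun j => by
      have := mul_le_of_le_one_right (sub_nonneg.2 hs1) (hw1 j)
      linarith) ?_
  · have h1 : 1 / (N : ℝ) * ∑ j, ((1 - s) * w j + s) = ε + s * (1 - ε) := by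
      rw [Finset.sum_add_distrib, ← Finset.mul_sum, hws]
      simp only [Finset.sum_const, Finset.card_univ, Fintype.card_fin, nsmul_eq_mul]
      field_simp
      ring
    have h2 := mul_pos hs0 (sub_pos.2 hε')
    linarith
  · have h1 : 1 / (N : ℝ) * ∑ j, ((1 - s) * w j + s) * gFun p v x (ξhat j) =
        (1 - s) * c + s * G := by
      simp only [add_mul, Finset.sum_add_distrib, mul_assoc, ← Finset.mul_sum, hc, hG]
      ring
    rw [h1]
    have := mul_nonneg hs0.le hc0
    linarith

theorem mem_feasibleRegion_iff {I n N : ℕ} [NeZero I] [NeZero N] {p : ℝ≥0∞}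
    (hp : 0 < p.toReal) {δ ε : ℝ} (hδ : 0 < δ) (hε : 0 < ε) (hε' : ε < 1) {v : Fin I → ℤ}
    (hv : ∀ i, 1 ≤ v i) (ξhat : Fin N → BinArray I n) (x : BinVec n) :
    x ∈ feasibleRegion p δ ε v ξhat ↔
      ∃ γ, δ + 1 / (N : ℝ) * ∑ j, max (γ - gFun p v x (ξhat j)) 0 ≤ ε * γ :=
  ⟨exists_le_of_mem_feasibleRegion hp hε hε' hv ξhat,
    fun ⟨_, hγ⟩ => mem_feasibleRegion_of_le hp hδ hε v ξhat x hγ⟩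

/-! ### The explicit and CVaR descriptions of the feasible region -/

theorem mainTheorem3 (n I N : ℕ) [NeZero I] [NeZero N] (p : ℝ≥0∞) (hp_one : 1 ≤ p)
    (hp_top : p ≠ ⊤) (δ ε : ℝ) (hδ : 0 < δ) (hε_pos : 0 < ε) (hε_lt : ε < 1)
    (v : Fin I → ℤ) (hv : ∀ i, 1 ≤ v i) (ξhat : Fin N → BinArray I n) :
    feasibleRegion p δ ε v ξhat =
        {x : BinVec n | ∃ γ : ℝ, ∃ z : Fin N → ℝ, 0 ≤ γ ∧ (∀ j, z j ≤ 0) ∧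
          δ - γ * ε ≤ 1 / (N : ℝ) * ∑ j, z j ∧
          ∀ j, z j + γ ≤ Finset.univ.inf' Finset.univ_nonempty (fun i : Fin I =>
            (max ((binDot x (ξhat j i) : ℝ) - (v i : ℝ) + 1) 0) ^ (1 / p.toReal))} ∧
    (∀ x : BinVec n,
      IsLeast (Set.range (cvarObjective (empirical ξhat) ε (fun ξ => -gFun p v x ξ)))
        (cvar (empirical ξhat) ε (fun ξ => -gFun p v x ξ))) ∧
    feasibleRegion p δ ε v ξhat =
        {x : BinVec n | δ / ε + cvar (empirical ξhat) ε (fun ξ => -gFun p v x ξ) ≤ 0} := by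
  have hp : 0 < p.toReal := ENNReal.toReal_pos (zero_lt_one.trans_le hp_one).ne' hp_top
  have hleast := fun x : BinVec n => isLeast_cvar_empirical ξhat hε_pos hε_lt (gFun p v x)
  refine ⟨?_, hleast, ?_⟩
  · ext x
    rw [mem_feasibleRegion_iff hp hδ hε_pos hε_lt hv]
    constructor
    · rintro ⟨γ, hγ⟩
      have hE : 0 ≤ 1 / (N : ℝ) * ∑ j, max (γ - gFun p v x (ξhat j)) 0 :=
        mul_nonneg (by positivity) (Finset.sum_nonneg fun _ _ => le_max_right _ _)
      -- The largest z_j allowed by both upper bounds.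
      refine ⟨γ, fun j => -max (γ - gFun p v x (ξhat j)) 0, ?_, fun j => ?_, ?_, fun j => ?_⟩
      · exact (pos_of_mul_pos_right (by linarith : 0 < ε * γ) hε_pos.le).le
      · exact neg_nonpos.2 (le_max_right _ _)
      · rw [Finset.sum_neg_distrib]
        linarith
      · change _ ≤ gFun p v x (ξhat j)
        have := le_max_left (γ - gFun p v x (ξhat j)) 0
        linarith
    · rintro ⟨γ, z, -, hz0, hz, hzg⟩
      refine ⟨γ, ?_⟩
      have h : 1 / (N : ℝ) * ∑ j, max (γ - gFun p v x (ξhat j)) 0 ≤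
          1 / (N : ℝ) * ∑ j, -z j := by
        refine mul_le_mul_of_nonneg_left (Finset.sum_le_sum fun j _ => max_le ?_ ?_)
          (by positivity)
        · have : z j + γ ≤ gFun p v x (ξhat j) := hzg j
          linarith
        · exact neg_nonneg.2 (hz0 j)
      rw [Finset.sum_neg_distrib] at h
      linarith
  · ext x
    rw [mem_feasibleRegion_iff hp hδ hε_pos hε_lt hv]
    have hiff : ∀ γ, δ + 1 / (N : ℝ) * ∑ j, max (γ - gFun p v x (ξhat j)) 0 ≤ ε * γ ↔
        δ / ε + cvarObjective (empirical ξhat) ε (fun ξ => -gFun p v x ξ) (-γ) ≤ 0 := fun γ => by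
      rw [cvarObjective_empirical ξhat hε_pos, ← add_div, div_le_iff₀ hε_pos, zero_mul]
      constructor <;> intro h <;> linarith
    simp only [hiff, Set.mem_ofPred_eq]
    constructor
    · rintro ⟨γ, hγ⟩
      have := (hleast x).2 ⟨-γ, rfl⟩
      linarith
    · intro h
      obtain ⟨t, ht⟩ := (hleast x).1
      exact ⟨-t, by rw [neg_neg, ht]; exact h⟩
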